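/- Let $k$ be a field, let $S=k[x_1,\dots,x_n]$ be the polynomial ring with its standard grading, and let $r\ge 1$. Let $u_1,\dots,u_r$ be a regular sequence in $S$ consisting of homogeneous polynomials, with $\deg u_i=d_i$ for $i=1,\dots,r$. Put $I=(u_1,\dots,u_r)$ and $w=\max\{d_i\mid 1\le i\le r\}$. Then $$\operatorname{reg}(I^t)=\sum_{i=1}^{r}d_i-(r-1)+(t-1)w\qquad\text{for all } t\ge 1.$$ Here, for a nonzero homogeneous ideal $J\subset S$ with finite minimal graded free resolution $0\to\bigoplus_j S(-j)^{\beta_{p,j}(J)}\to\cdots\to\bigoplus_j S(-j)^{\beta_{0,j}(J)}\to J\to 0$, the regularity is $\operatorname{reg}(J)=\max\{j-i\mid \beta_{i,j}(J)\ne 0\}$. -/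

import Mathlib

/-- In the graded free module `⨁ c, S(-s c)` over `S = k[x₁,…,xₙ]` with its standard grading, the
vector `x` is homogeneous of degree `e`: its coordinate at `c` is a homogeneous polynomial of degree
`e - s c` (so it is zero when `e < s c`). The zero vector is homogeneous of every degree. -/
def IsHomogeneousVector {k : Type*} [Field k] {n m : ℕ} (s : Fin m → ℤ) (e : ℤ)
    (x : Fin m → MvPolynomial (Fin n) k) : Prop :=
  ∀ c : Fin m, ∀ a ∈ (x c).support, (a.degree : ℤ) + s c = e

/-- A minimal graded free resolution of finite length, with terms of finite rank, of an ideal `I` of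
`S = k[x₁,…,xₙ]`:
`⋯ → F₂ → F₁ → F₀ → I → 0` with `Fᵢ = ⨁ b, S(-shift i b)`. -/
structure MinimalGradedFreeResolution {k : Type*} [Field k] {n : ℕ}
    (I : Ideal (MvPolynomial (Fin n) k)) where
  /-- The rank of `Fᵢ`. -/
  rank : ℕ → ℕ
  /-- The degrees of the basis elements of `Fᵢ`. -/
  shift : ∀ i, Fin (rank i) → ℤ
  /-- The augmentation `F₀ → S`, with image `I`. -/
  aug : (Fin (rank 0) → MvPolynomial (Fin n) k) →ₗ[MvPolynomial (Fin n) k]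
    MvPolynomial (Fin n) k
  /-- The differential `Fᵢ₊₁ → Fᵢ`. -/
  diff : ∀ i, (Fin (rank (i + 1)) → MvPolynomial (Fin n) k) →ₗ[MvPolynomial (Fin n) k]
    (Fin (rank i) → MvPolynomial (Fin n) k)
  /-- The augmentation is a graded map of degree zero. -/
  aug_homogeneous : ∀ e x, IsHomogeneousVector (shift 0) e x →
    ∀ a ∈ (aug x).support, (a.degree : ℤ) = e
  /-- The differentials are graded maps of degree zero. -/
  diff_homogeneous : ∀ i e x, IsHomogeneousVector (shift (i + 1)) e x →
    IsHomogeneousVector (shift i) e (diff i x)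
  range_aug : LinearMap.range aug = I
  exact_zero : Function.Exact (diff 0) aug
  exact_succ : ∀ i, Function.Exact (diff (i + 1)) (diff i)
  /-- Minimality: the image of each differential lies in `(x₁,…,xₙ) Fᵢ`. -/
  minimal : ∀ i x c, MvPolynomial.constantCoeff (diff i x c) = 0
  /-- The resolution has finite length. -/
  finite_length : ∃ p, ∀ i, p < i → rank i = 0

/-- The graded Betti number `β_{i,j}`: the number of summands `S(-j)` in the `i`-th term. -/
def MinimalGradedFreeResolution.betti {k : Type*} [Field k] {n : ℕ}
    {I : Ideal (MvPolynomial (Fin n) k)} (F : MinimalGradedFreeResolution I) (i : ℕ) (j : ℤ) : ℕ :=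
  (Finset.univ.filter fun b : Fin (F.rank i) => F.shift i b = j).card

/-- `reg(I) = ρ`, where `reg(I) = max {j - i | β_{i,j}(I) ≠ 0}`: a minimal graded free resolution of
`I` exists, and whichever one is used to compute the graded Betti numbers, the maximum exists and is
equal to `ρ`. -/
def HasRegularity {k : Type*} [Field k] {n : ℕ} (I : Ideal (MvPolynomial (Fin n) k)) (ρ : ℤ) :
    Prop :=
  Nonempty (MinimalGradedFreeResolution I) ∧
    ∀ F : MinimalGradedFreeResolution I,
      IsGreatest {m : ℤ | ∃ (i : ℕ) (j : ℤ), F.betti i j ≠ 0 ∧ m = j - i} ρ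

/-! ### Regular sequences and powers of the ideal they generate. -/

namespace Ideal

variable {R : Type*} [CommRing R]

/-! The proof adjoins the generators one at a time and builds explicit minimal resolutions of all
powers. Let `J` be generated by the earlier elements, `f` the next one, of degree `d`, and `I = J +
(f)`. Then `I^(t+1) = J^(t+1) + f I^t`. Since `f` is a nonzerodivisor modulo `J^(t+1)`, the two
summands meet in `f J^(t+1)`, so `a ↦ (f a, -a)` gives an exact sequence `0 → J^(t+1)(-d) → J^(t+1)
⊕ I^t(-d) → I^(t+1) → 0`.

The mapping cone of a lift of the first map therefore resolves `I^(t+1)`. It is minimal: `f` has no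
constant term, and the inclusion `J^(t+1) ≤ I^t` factors through `J^t`, where the induction supplies
a lift of `J^(t+1) ≤ J^t` with entries in the irrelevant ideal. The cone also carries such a lift of
`I^(t+1) ≤ I^t`, so the construction can be repeated for the next generator.

Reading off the shifts gives `reg I^(t+1) = max (reg J^(t+1) + d - 1) (reg I^t + d)`, whose solution
is the stated formula. Comparing two minimal resolutions modulo the irrelevant ideal shows that the
set of nonzero Betti positions, hence the regularity, does not depend on the resolution. -/

theorem sup_span_singleton_pow_succ (J : Ideal R) (f : R) (t : ℕ) :
    (J ⊔ span {f}) ^ (t + 1) = J ^ (t + 1) ⊔ span {f} * (J ⊔ span {f}) ^ t := by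
  apply le_antisymm
  · induction t with
    | zero => simp
    | succ t ih =>
      rw [pow_succ' _ (t + 1), sup_mul]
      refine sup_le ?_ le_sup_right
      refine (mul_mono_right ih).trans ?_
      rw [mul_sup, ← pow_succ', mul_left_comm, pow_succ' _ t]
      exact sup_le_sup_left (mul_mono_right (mul_mono_left le_sup_left)) _
  · refine sup_le (pow_right_mono le_sup_left _) ?_
    rw [pow_succ']
    exact mul_mono_left le_sup_right

/-- For every ideal `K` containing `J`, every nonzerodivisor on `R ⧸ K` is a nonzerodivisor on all
`J ^ t ⧸ K * J ^ t`. This holds when each `J ^ t ⧸ J ^ (t + 1)` is a free `R ⧸ J`-module. -/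
def PreservesNonzerodivisors (J : Ideal R) : Prop :=
  ∀ K : Ideal R, J ≤ K → ∀ g : R, (∀ x, g * x ∈ K → x ∈ K) →
    ∀ (t : ℕ) (x : R), x ∈ J ^ t → g * x ∈ K * J ^ t → x ∈ K * J ^ t

theorem preservesNonzerodivisors_bot : (⊥ : Ideal R).PreservesNonzerodivisors := by
  intro K _ g hg t x hx hgx
  cases t with
  | zero => simpa using hg x (by simpa using hgx)
  | succ t =>
    have : x = 0 := by simpa [pow_succ] using hx
    simp [this]

/-- The case `K = J`, climbed along `J ^ t ⊇ J ^ (t + 1)`. This is the injectivity modulo powers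
that the mapping cones need. -/
theorem PreservesNonzerodivisors.mem_pow {J : Ideal R} (hJ : J.PreservesNonzerodivisors) {g : R}
    (hg : ∀ x, g * x ∈ J → x ∈ J) (t : ℕ) {x : R} (hx : g * x ∈ J ^ t) : x ∈ J ^ t := by
  induction t with
  | zero => simp
  | succ t ih =>
    rw [pow_succ'] at hx ⊢
    exact hJ J le_rfl g hg t x (ih (mul_le_right hx)) hx

/-- The property for `J` is applied to an ideal `K` that also contains `f`; this is why its
definition allows every `K` above `J` and not only `J` itself. -/
theorem PreservesNonzerodivisors.sup_span_singleton {J : Ideal R}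
    (hJ : J.PreservesNonzerodivisors) {f : R} (hf : ∀ x, f * x ∈ J → x ∈ J) :
    (J ⊔ span {f}).PreservesNonzerodivisors := by
  intro K hK g hg t
  have hJK : J ≤ K := le_sup_left.trans hK
  have hfK : f ∈ K := hK (mem_sup_right (mem_span_singleton_self f))
  induction t with
  | zero => intro x _ hx; simpa using hg x (by simpa using hx)
  | succ t ih =>
    intro x hx hgx
    rw [sup_span_singleton_pow_succ] at hx hgx ⊢
    rw [mul_sup, mul_left_comm] at hgx ⊢
    obtain ⟨a, ha, y, hy, rfl⟩ := Submodule.mem_sup.mp hx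
    obtain ⟨b, hb, rfl⟩ := mem_span_singleton_mul.mp hy
    obtain ⟨p, hp, z, hz, hpz⟩ := Submodule.mem_sup.mp hgx
    obtain ⟨q, hq, rfl⟩ := mem_span_singleton_mul.mp hz
    -- Compare `g * (a + f * b) = p + f * q`: the multiple `f * (g * b - q)` lies in `J ^ (t + 1)`,
    -- and `f` can be cancelled there. As `f ∈ K`, the error term is harmless in both components.
    have h1 : g * b - q ∈ J ^ (t + 1) := by
      refine hJ.mem_pow hf _ ?_
      have : f * (g * b - q) = p - g * a := by linear_combination -hpz
      rw [this]
      exact sub_mem (mul_le_right hp) (mul_mem_left _ _ ha)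
    refine Submodule.add_mem_sup ?_ (mem_span_singleton_mul.mpr ⟨b, ?_, rfl⟩)
    · refine hJ K hJK g hg _ _ ha ?_
      have : g * a = p - f * (g * b - q) := by linear_combination -hpz
      rw [this]
      exact sub_mem hp (mul_mem_mul hfK h1)
    · refine ih b hb ?_
      have : g * b = (g * b - q) + q := by ring
      rw [this]
      refine add_mem ?_ hq
      rw [pow_succ'] at h1
      exact mul_mono hJK (pow_right_mono le_sup_left t) h1

end Ideal
-- Homogeneous vectors over an arbitrary index type.
open MvPolynomial

/-- The vector `x` in the free module with basis elements of degrees `s` is homogeneous of degree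
`e`. -/
def IsHomogeneousFamily {k : Type*} [Field k] {n : ℕ} {ι : Type*} (s : ι → ℤ) (e : ℤ)
    (x : ι → MvPolynomial (Fin n) k) : Prop :=
  ∀ c, ∀ a ∈ (x c).support, (a.degree : ℤ) + s c = e

section Homogeneous

variable {k : Type*} [Field k] {n : ℕ} {ι : Type*} {s : ι → ℤ} {e : ℤ}
  {x y : ι → MvPolynomial (Fin n) k}

theorem IsHomogeneousFamily.add (hx : IsHomogeneousFamily s e x) (hy : IsHomogeneousFamily s e y) :
    IsHomogeneousFamily s e (x + y) := by
  classical
  intro c a ha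
  rcases Finset.mem_union.mp (support_add ha) with h | h
  exacts [hx c a h, hy c a h]

theorem IsHomogeneousFamily.neg (hx : IsHomogeneousFamily s e x) :
    IsHomogeneousFamily s e (-x) := by
  intro c a ha
  exact hx c a (by simpa [mem_support_iff] using ha)

theorem IsHomogeneousFamily.sub (hx : IsHomogeneousFamily s e x) (hy : IsHomogeneousFamily s e y) :
    IsHomogeneousFamily s e (x - y) := by
  rw [sub_eq_add_neg]
  exact hx.add hy.neg

theorem isHomogeneousFamily_zero : IsHomogeneousFamily (k := k) (n := n) s e 0 := by
  intro c a ha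
  simp at ha

theorem IsHomogeneousFamily.smul {f : MvPolynomial (Fin n) k} {d : ℕ} (hf : f.IsHomogeneous d)
    (hx : IsHomogeneousFamily s e x) : IsHomogeneousFamily s (e + d) (f • x) := by
  classical
  intro c a ha
  obtain ⟨b, hb, b', hb', rfl⟩ := Finset.mem_add.mp (support_mul _ _ ha)
  have h1 : b.degree = d := by
    rw [Finsupp.degree_eq_weight_one]
    exact hf (mem_support_iff.mp hb)
  have h2 := hx c b' hb'
  rw [map_add]
  push_cast
  omega

theorem IsHomogeneousFamily.add_const (hx : IsHomogeneousFamily s e x) (d : ℤ) :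
    IsHomogeneousFamily (fun c => s c + d) (e + d) x := by
  intro c a ha
  have := hx c a ha
  simp only
  omega

theorem IsHomogeneousFamily.of_add_const {d : ℤ}
    (hx : IsHomogeneousFamily (fun c => s c + d) e x) :
    IsHomogeneousFamily s (e - d) x := by
  intro c a ha
  have := hx c a ha
  simp only at this
  omega

end Homogeneous

/-! ### Resolutions as total objects, and their morphisms. -/

/-- A finite free module over `k[x₁,…,xₙ]` with a basis whose elements carry a homological degree
and an internal degree, with an endomorphism and a linear form. -/
structure CellComplex (k : Type*) [Field k] (n : ℕ) where
  /-- The basis. -/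
  Cell : Type
  /-- The homological degree. -/
  hdeg : Cell → ℕ
  /-- The internal degree. -/
  deg : Cell → ℤ
  /-- The differential. -/
  D : (Cell → MvPolynomial (Fin n) k) →ₗ[MvPolynomial (Fin n) k] (Cell → MvPolynomial (Fin n) k)
  /-- The augmentation. -/
  ε : (Cell → MvPolynomial (Fin n) k) →ₗ[MvPolynomial (Fin n) k] MvPolynomial (Fin n) k

namespace CellComplex

variable {k : Type*} [Field k] {n : ℕ}

/-- The free module of a cell complex. -/
abbrev Mod (A : CellComplex k n) := A.Cell → MvPolynomial (Fin n) k

/-- The cell complex is the total object of a minimal graded free resolution of `I`. -/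
structure Resolves (A : CellComplex k n) (I : Ideal (MvPolynomial (Fin n) k)) : Prop where
  finite : Finite A.Cell
  D_homogeneous : ∀ e x, IsHomogeneousFamily A.deg e x → IsHomogeneousFamily A.deg e (A.D x)
  D_local : ∀ x b, (∀ c, A.hdeg c = A.hdeg b + 1 → x c = 0) → A.D x b = 0
  ε_homogeneous : ∀ e x, IsHomogeneousFamily A.deg e x → ∀ a ∈ (A.ε x).support, (a.degree : ℤ) = e
  ε_local : ∀ x, (∀ b, A.hdeg b = 0 → x b = 0) → A.ε x = 0
  minimal : ∀ x b, constantCoeff (A.D x b) = 0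
  D_D : ∀ x, A.D (A.D x) = 0
  ε_D : ∀ x, A.ε (A.D x) = 0
  exact : ∀ x, A.D x = 0 → A.ε x = 0 → ∃ y, A.D y = x
  ε_mem : ∀ x, A.ε x ∈ I
  exists_ε_eq : ∀ p ∈ I, ∃ x, A.D x = 0 ∧ A.ε x = p

/-- Morphisms over the inclusion of ideals. -/
structure IsMorphism (A B : CellComplex k n)
    (ψ : A.Mod →ₗ[MvPolynomial (Fin n) k] B.Mod) : Prop where
  D_comm : ∀ x, ψ (A.D x) = B.D (ψ x)
  ε_comm : ∀ x, B.ε (ψ x) = A.ε x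
  homogeneous : ∀ e x, IsHomogeneousFamily A.deg e x → IsHomogeneousFamily B.deg e (ψ x)
  local_apply : ∀ x b, (∀ c, A.hdeg c = B.hdeg b → x c = 0) → ψ x b = 0

/-- The image of the map lies in the multiples of the irrelevant ideal. -/
def IsMinimalMap (A B : CellComplex k n) (ψ : A.Mod →ₗ[MvPolynomial (Fin n) k] B.Mod) : Prop :=
  ∀ x b, constantCoeff (ψ x b) = 0

/-- The largest value of `deg - hdeg` on the cells is `m`. -/
def HasTop (A : CellComplex k n) (m : ℤ) : Prop :=
  (∃ b, A.deg b - A.hdeg b = m) ∧ ∀ b, A.deg b - A.hdeg b ≤ m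

theorem IsMorphism.comp {A B C : CellComplex k n}
    {ψ : A.Mod →ₗ[MvPolynomial (Fin n) k] B.Mod} {χ : B.Mod →ₗ[MvPolynomial (Fin n) k] C.Mod}
    (hχ : IsMorphism B C χ) (hψ : IsMorphism A B ψ) : IsMorphism A C (χ ∘ₗ ψ) where
  D_comm x := by simp [hψ.D_comm, hχ.D_comm]
  ε_comm x := by simp [hψ.ε_comm, hχ.ε_comm]
  homogeneous e x hx := hχ.homogeneous e _ (hψ.homogeneous e x hx)
  local_apply x b hx := hχ.local_apply _ b fun c hc => hψ.local_apply x c fun a ha =>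
    hx a (ha.trans hc)

theorem isMorphism_id (A : CellComplex k n) : IsMorphism A A LinearMap.id :=
  ⟨fun _ => rfl, fun _ => rfl, fun _ _ h => h, fun _ b h => h b rfl⟩

/-- A linear map whose image has constant terms zero still has this after composing with a linear
map. -/
theorem constantCoeff_map_eq_zero {ι κ : Type*} [Finite ι]
    (χ : (ι → MvPolynomial (Fin n) k) →ₗ[MvPolynomial (Fin n) k] (κ → MvPolynomial (Fin n) k))
    {x : ι → MvPolynomial (Fin n) k} (hx : ∀ b, constantCoeff (x b) = 0) (c : κ) :
    constantCoeff (χ x c) = 0 := by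
  classical
  have := Fintype.ofFinite ι
  rw [LinearMap.pi_apply_eq_sum_univ χ x]
  simp [Finset.sum_apply, hx]

/-! ### The mapping cone that resolves `J + f I`. -/

section Cone

variable (A B : CellComplex k n) (ψ : A.Mod →ₗ[MvPolynomial (Fin n) k] B.Mod)
  (f : MvPolynomial (Fin n) k) (d : ℕ)

/-- The mapping cone of `(f, -ψ) : A(-d) → A ⊕ B(-d)`. -/
noncomputable def cone : CellComplex k n where
  Cell := A.Cell ⊕ A.Cell ⊕ B.Cell
  hdeg := Sum.elim (fun b => A.hdeg b + 1) (Sum.elim A.hdeg B.hdeg)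
  deg := Sum.elim (fun b => A.deg b + d) (Sum.elim A.deg fun b => B.deg b + d)
  D :=
    { toFun := fun x => Sum.elim (-A.D (x ∘ Sum.inl))
        (Sum.elim (A.D (x ∘ Sum.inr ∘ Sum.inl) + f • (x ∘ Sum.inl))
          (B.D (x ∘ Sum.inr ∘ Sum.inr) - ψ (x ∘ Sum.inl)))
      map_add' := by
        intro x y
        simp only [Pi.add_comp, map_add, smul_add]
        ext (i | i | i) : 1 <;> simp <;> ring
      map_smul' := by
        intro r x
        simp only [Pi.smul_comp, map_smul]
        ext (i | i | i) : 1 <;> simp <;> ring }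
  ε :=
    { toFun := fun x => A.ε (x ∘ Sum.inr ∘ Sum.inl) + f * B.ε (x ∘ Sum.inr ∘ Sum.inr)
      map_add' := by
        intro x y
        simp only [Pi.add_comp, map_add]
        ring
      map_smul' := by
        intro r x
        simp only [Pi.smul_comp, map_smul, smul_eq_mul, RingHom.id_apply]
        ring }

/-- The inclusion of `A` in the cone. -/
noncomputable def coneInclusion : A.Mod →ₗ[MvPolynomial (Fin n) k] (cone A B ψ f d).Mod where
  toFun x := Sum.elim 0 (Sum.elim x 0)
  map_add' x y := by
    ext (i | i | i) : 1
    exacts [(add_zero 0).symm, rfl, (add_zero 0).symm]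
  map_smul' r x := by
    ext (i | i | i) : 1
    exacts [(smul_zero r).symm, rfl, (smul_zero r).symm]

/-- The map `(a, b, c) ↦ ψ b + f c` from the cone to `B`. -/
noncomputable def coneProjection : (cone A B ψ f d).Mod →ₗ[MvPolynomial (Fin n) k] B.Mod where
  toFun x := ψ (x ∘ Sum.inr ∘ Sum.inl) + f • (x ∘ Sum.inr ∘ Sum.inr)
  map_add' x y := by
    simp only [Pi.add_comp, map_add, smul_add]
    abel
  map_smul' r x := by
    simp only [Pi.smul_comp, map_smul, smul_add, RingHom.id_apply, smul_comm f r]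

variable {A B ψ f d}

theorem cone_cases (x : (cone A B ψ f d).Mod) :
    ∃ (a b : A.Mod) (c : B.Mod), x = Sum.elim a (Sum.elim b c) :=
  ⟨x ∘ Sum.inl, x ∘ Sum.inr ∘ Sum.inl, x ∘ Sum.inr ∘ Sum.inr, by
    ext (i | i | i) : 1 <;> rfl⟩

theorem cone_D_elim (a b : A.Mod) (c : B.Mod) :
    (cone A B ψ f d).D (Sum.elim a (Sum.elim b c)) =
      Sum.elim (-A.D a) (Sum.elim (A.D b + f • a) (B.D c - ψ a)) := rfl

theorem cone_ε_elim (a b : A.Mod) (c : B.Mod) :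
    (cone A B ψ f d).ε (Sum.elim a (Sum.elim b c)) = A.ε b + f * B.ε c := rfl

theorem isMorphism_coneInclusion : IsMorphism A (cone A B ψ f d) (coneInclusion A B ψ f d) where
  D_comm x := by
    change Sum.elim _ _ = Sum.elim (-A.D 0) (Sum.elim (A.D x + f • 0) (B.D 0 - ψ 0))
    simp
  ε_comm x := by
    change A.ε x + f * B.ε 0 = _
    simp
  homogeneous e x hx := by
    rintro (c | c | c)
    · exact isHomogeneousFamily_zero (s := fun b => A.deg b + d) c
    · exact hx c
    · exact isHomogeneousFamily_zero (s := fun b => B.deg b + d) c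
  local_apply x := by
    rintro (c | c | c) hx
    · rfl
    · exact hx c rfl
    · rfl

/-- The two terms `f • ψ a` cancel, and since `ψ` preserves augmentations the map lifts the
inclusion of `J + f I` in `I`. -/
theorem isMorphism_coneProjection (hψ : IsMorphism A B ψ) (hf : f.IsHomogeneous d) :
    IsMorphism (cone A B ψ f d) B (coneProjection A B ψ f d) where
  D_comm x := by
    obtain ⟨a, b, c, rfl⟩ := cone_cases x
    change ψ (A.D b + f • a) + f • (B.D c - ψ a) = B.D (ψ b + f • c)
    simp only [map_add, map_smul, smul_sub, hψ.D_comm]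
    abel
  ε_comm x := by
    obtain ⟨a, b, c, rfl⟩ := cone_cases x
    change B.ε (ψ b + f • c) = A.ε b + f * B.ε c
    simp [hψ.ε_comm]
  homogeneous e x hx := by
    refine (hψ.homogeneous e _ fun c => hx (Sum.inr (Sum.inl c))).add ?_
    have : IsHomogeneousFamily B.deg (e - d) (x ∘ Sum.inr ∘ Sum.inr) :=
      IsHomogeneousFamily.of_add_const fun c => hx (Sum.inr (Sum.inr c))
    simpa using this.smul hf
  local_apply x c hx := by
    change ψ _ c + f * x (Sum.inr (Sum.inr c)) = 0
    rw [hψ.local_apply (x ∘ Sum.inr ∘ Sum.inl) c fun b hb => hx (Sum.inr (Sum.inl b)) hb,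
      hx (Sum.inr (Sum.inr c)) rfl]
    simp

theorem isMinimalMap_coneProjection (hψ : IsMinimalMap A B ψ) (hf : constantCoeff f = 0) :
    IsMinimalMap (cone A B ψ f d) B (coneProjection A B ψ f d) := by
  intro x b
  change constantCoeff (ψ _ b + f * _) = 0
  rw [map_add, hψ, map_mul, hf]
  simp

/-- A diagram chase. The nonzerodivisor hypothesis says that a relation `p + f q = 0` with `p ∈ J`,
`q ∈ I` has `q ∈ J`, so it comes from the copy of `A` in the cone. -/
theorem cone_exact {J I : Ideal (MvPolynomial (Fin n) k)} (hA : A.Resolves J) (hB : B.Resolves I)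
    (hψ : IsMorphism A B ψ) (hf0 : f ≠ 0) (hfJ : ∀ x, f * x ∈ J → x ∈ J)
    (x : (cone A B ψ f d).Mod) (hD : (cone A B ψ f d).D x = 0)
    (hε : (cone A B ψ f d).ε x = 0) : ∃ y, (cone A B ψ f d).D y = x := by
  obtain ⟨a, b, c, rfl⟩ := cone_cases x
  rw [cone_D_elim] at hD
  rw [cone_ε_elim] at hε
  have hDa : A.D a = 0 := by
    ext1 i; exact neg_eq_zero.mp (congrFun hD (Sum.inl i))
  have hDb : A.D b + f • a = 0 := by
    ext1 i; exact congrFun hD (Sum.inr (Sum.inl i))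
  have hDc : B.D c - ψ a = 0 := by
    ext1 i; exact congrFun hD (Sum.inr (Sum.inr i))
  have hεa : A.ε a = 0 := by
    have := congrArg A.ε hDb
    simpa [hA.ε_D, hf0] using this
  obtain ⟨y, rfl⟩ := hA.exact a hDa hεa
  have hDb' : A.D (b + f • y) = 0 := by simpa using hDb
  have hDc' : B.D (c - ψ y) = 0 := by simpa [hψ.D_comm] using hDc
  have hε' : A.ε (b + f • y) + f * B.ε (c - ψ y) = 0 := by
    simp only [map_add, map_smul, map_sub, hψ.ε_comm, smul_eq_mul]
    linear_combination hε
  have hc : -B.ε (c - ψ y) ∈ J := by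
    refine hfJ _ ?_
    have : f * -B.ε (c - ψ y) = A.ε (b + f • y) := by linear_combination -hε'
    rw [this]
    exact hA.ε_mem _
  -- The preimage `y` of `a` is determined only up to cycles. The cycle `z` corrects it so that both
  -- remaining components have augmentation zero.
  obtain ⟨z, hDz, hεz⟩ := hA.exists_ε_eq _ hc
  obtain ⟨β, hβ⟩ := hA.exact (b + f • y - f • z) (by simp [hDb', hDz, -map_add]) (by
    rw [map_sub, map_smul, hεz, smul_eq_mul]
    linear_combination hε')
  obtain ⟨γ, hγ⟩ := hB.exact (c - ψ y + ψ z) (by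
    rw [map_add, hDc', ← hψ.D_comm, hDz]; simp) (by
    rw [map_add, hψ.ε_comm, hεz]
    ring)
  refine ⟨Sum.elim (z - y) (Sum.elim β γ), ?_⟩
  rw [cone_D_elim, hβ, hγ, map_sub, map_sub, hDz, smul_sub]
  congr 1
  · simp
  · congr 1 <;> abel

theorem resolves_cone {J I : Ideal (MvPolynomial (Fin n) k)} (hA : A.Resolves J)
    (hB : B.Resolves I) (hψ : IsMorphism A B ψ) (hψm : IsMinimalMap A B ψ)
    (hf : f.IsHomogeneous d) (hfc : constantCoeff f = 0) (hf0 : f ≠ 0)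
    (hfJ : ∀ x, f * x ∈ J → x ∈ J) :
    (cone A B ψ f d).Resolves (J ⊔ Ideal.span {f} * I) where
  finite := by
    have := hA.finite
    have := hB.finite
    exact inferInstanceAs (Finite (A.Cell ⊕ A.Cell ⊕ B.Cell))
  D_homogeneous e x hx := by
    obtain ⟨a, b, c, rfl⟩ := cone_cases x
    have ha : IsHomogeneousFamily A.deg (e - d) a :=
      IsHomogeneousFamily.of_add_const fun c => hx (Sum.inl c)
    have hb : IsHomogeneousFamily A.deg e b := fun c => hx (Sum.inr (Sum.inl c))
    have hc : IsHomogeneousFamily B.deg (e - d) c :=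
      IsHomogeneousFamily.of_add_const fun c => hx (Sum.inr (Sum.inr c))
    have h1 := (hA.D_homogeneous _ _ ha).neg.add_const d
    have h2 := (hA.D_homogeneous _ _ hb).add (by simpa using ha.smul hf)
    have h3 := ((hB.D_homogeneous _ _ hc).sub (hψ.homogeneous _ _ ha)).add_const d
    rw [sub_add_cancel] at h1 h3
    rintro (i | i | i)
    · exact h1 i
    · exact h2 i
    · exact h3 i
  D_local x := by
    obtain ⟨a, b, c, rfl⟩ := cone_cases x
    rintro (j | j | j) hx
    · change -A.D a j = 0
      rw [hA.D_local a j fun l hl => hx (Sum.inl l) (congrArg (· + 1) hl), neg_zero]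
    · change A.D b j + f * a j = 0
      rw [hA.D_local b j fun l hl => hx (Sum.inr (Sum.inl l)) hl,
        show a j = 0 from hx (Sum.inl j) rfl]
      simp
    · change B.D c j - ψ a j = 0
      rw [hB.D_local c j fun l hl => hx (Sum.inr (Sum.inr l)) hl,
        hψ.local_apply a j fun l hl => hx (Sum.inl l) (congrArg (· + 1) hl), sub_zero]
  ε_homogeneous e x hx := by
    classical
    obtain ⟨a, b, c, rfl⟩ := cone_cases x
    have hb : IsHomogeneousFamily A.deg e b := fun c => hx (Sum.inr (Sum.inl c))
    have hc : IsHomogeneousFamily B.deg (e - d) c :=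
      IsHomogeneousFamily.of_add_const fun c => hx (Sum.inr (Sum.inr c))
    have h1 : IsHomogeneousFamily (fun _ : Unit => 0) e (fun _ => A.ε b) := fun _ m hm => by
      simpa using hA.ε_homogeneous e b hb m hm
    have h2 : IsHomogeneousFamily (fun _ : Unit => 0) (e - d) (fun _ => B.ε c) := fun _ m hm => by
      simpa using hB.ε_homogeneous _ c hc m hm
    intro m hm
    have h3 := h1.add (by simpa using h2.smul hf)
    simpa using h3 () m hm
  ε_local x hx := by
    obtain ⟨a, b, c, rfl⟩ := cone_cases x
    rw [cone_ε_elim, hA.ε_local b fun i => hx (Sum.inr (Sum.inl i)),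
      hB.ε_local c fun i => hx (Sum.inr (Sum.inr i))]
    simp
  minimal x := by
    obtain ⟨a, b, c, rfl⟩ := cone_cases x
    rintro (i | i | i)
    · change constantCoeff (-A.D a i) = 0
      rw [map_neg, hA.minimal, neg_zero]
    · change constantCoeff (A.D b i + f * a i) = 0
      rw [map_add, hA.minimal, map_mul, hfc]
      simp
    · change constantCoeff (B.D c i - ψ a i) = 0
      rw [map_sub, hB.minimal, hψm, sub_zero]
  D_D x := by
    obtain ⟨a, b, c, rfl⟩ := cone_cases x
    rw [cone_D_elim, cone_D_elim]
    ext (i | i | i) : 1 <;> simp [hA.D_D, hB.D_D, hψ.D_comm] <;> rfl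
  ε_D x := by
    obtain ⟨a, b, c, rfl⟩ := cone_cases x
    rw [cone_D_elim, cone_ε_elim]
    simp [hA.ε_D, hB.ε_D, hψ.ε_comm]
  exact := cone_exact hA hB hψ hf0 hfJ
  ε_mem x := by
    obtain ⟨a, b, c, rfl⟩ := cone_cases x
    rw [cone_ε_elim]
    exact Submodule.add_mem_sup (hA.ε_mem b)
      (Ideal.mem_span_singleton_mul.mpr ⟨_, hB.ε_mem c, rfl⟩)
  exists_ε_eq p hp := by
    obtain ⟨q, hq, y, hy, rfl⟩ := Submodule.mem_sup.mp hp
    obtain ⟨z, hz, rfl⟩ := Ideal.mem_span_singleton_mul.mp hy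
    obtain ⟨b, hb, rfl⟩ := hA.exists_ε_eq q hq
    obtain ⟨c, hc, rfl⟩ := hB.exists_ε_eq z hz
    refine ⟨Sum.elim 0 (Sum.elim b c), ?_, rfl⟩
    rw [cone_D_elim, hb, hc]
    ext (i | i | i) : 1 <;> simp <;> rfl

end Cone

end CellComplex

/-! ### Lifting graded maps through graded maps. -/

section HomogeneousLift

variable {k : Type*} [Field k] {n : ℕ} {ι κ μ : Type*}

theorem IsHomogeneousFamily.smul_of_support {s : ι → ℤ} {m e : ℤ} {p : MvPolynomial (Fin n) k}
    (hp : ∀ a ∈ p.support, (a.degree : ℤ) + m = e) {x : ι → MvPolynomial (Fin n) k}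
    (hx : IsHomogeneousFamily s m x) : IsHomogeneousFamily s e (p • x) := by
  classical
  intro c a ha
  obtain ⟨b, hb, b', hb', rfl⟩ := Finset.mem_add.mp (support_mul _ _ ha)
  have h1 := hp b hb
  have h2 := hx c b' hb'
  rw [map_add]
  push_cast
  omega

theorem IsHomogeneousFamily.sum {s : ι → ℤ} {e : ℤ} {J : Type*} (T : Finset J)
    (x : J → ι → MvPolynomial (Fin n) k) (hx : ∀ j ∈ T, IsHomogeneousFamily s e (x j)) :
    IsHomogeneousFamily s e (∑ j ∈ T, x j) := by
  classical
  induction T using Finset.induction_on with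
  | empty => simpa using isHomogeneousFamily_zero
  | insert j T hj ih =>
    rw [Finset.sum_insert hj]
    exact (hx j (Finset.mem_insert_self _ _)).add
      (ih fun i hi => hx i (Finset.mem_insert_of_mem hi))

theorem isHomogeneousFamily_single [DecidableEq ι] (s : ι → ℤ) (b : ι) :
    IsHomogeneousFamily s (s b) (Pi.single b (1 : MvPolynomial (Fin n) k)) := by
  intro c a ha
  by_cases h : c = b
  · subst h
    rw [Pi.single_eq_same, mem_support_iff, coeff_one] at ha
    have : a = 0 := by
      by_contra h0
      exact ha (if_neg (Ne.symm h0))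
    simp [this]
  · simp [Pi.single_eq_of_ne h] at ha

/-- The homogeneous component of degree `e` of a vector. -/
noncomputable def homogeneousFamilyComponent (s : ι → ℤ) (e : ℤ)
    (x : ι → MvPolynomial (Fin n) k) : ι → MvPolynomial (Fin n) k :=
  fun c => if s c ≤ e then homogeneousComponent (e - s c).toNat (x c) else 0

theorem coeff_homogeneousFamilyComponent (s : ι → ℤ) (e : ℤ) (x : ι → MvPolynomial (Fin n) k)
    (c : ι) (a : Fin n →₀ ℕ) :
    coeff a (homogeneousFamilyComponent s e x c) =
      if (a.degree : ℤ) + s c = e then coeff a (x c) else 0 := by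
  unfold homogeneousFamilyComponent
  by_cases h : s c ≤ e
  · rw [if_pos h, coeff_homogeneousComponent]
    congr 1
    rw [eq_iff_iff]
    omega
  · rw [if_neg h, if_neg (by omega), coeff_zero]

theorem isHomogeneousFamily_component (s : ι → ℤ) (e : ℤ) (x : ι → MvPolynomial (Fin n) k) :
    IsHomogeneousFamily s e (homogeneousFamilyComponent s e x) := by
  intro c a ha
  rw [mem_support_iff, coeff_homogeneousFamilyComponent] at ha
  by_contra h
  exact ha (if_neg h)

theorem exists_sum_homogeneousFamilyComponent [Finite ι] (s : ι → ℤ) (e : ℤ)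
    (x : ι → MvPolynomial (Fin n) k) :
    ∃ E : Finset ℤ, e ∈ E ∧ ∑ j ∈ E, homogeneousFamilyComponent s j x = x := by
  classical
  have := Fintype.ofFinite ι
  -- All degrees of monomials of `x`, together with `e`, so that the degree `e` term is in the sum
  -- even when it vanishes.
  refine ⟨insert e (Finset.univ.biUnion fun c => (x c).support.image fun a => (a.degree : ℤ) + s c),
    Finset.mem_insert_self _ _, ?_⟩
  ext c a
  rw [Finset.sum_apply, coeff_sum]
  simp_rw [coeff_homogeneousFamilyComponent]
  rw [Finset.sum_ite_eq]
  split_ifs with h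
  · rfl
  · by_contra h0
    refine h (Finset.mem_insert_of_mem (Finset.mem_biUnion.mpr ⟨c, Finset.mem_univ _, ?_⟩))
    exact Finset.mem_image.mpr ⟨a, mem_support_iff.mpr fun h' => h0 h'.symm, rfl⟩

/-- The degree `e` component of `y` works: the other components map to other degrees and cannot
contribute to `δ y`. -/
theorem exists_homogeneous_preimage [Finite ι] {s : ι → ℤ} {t : κ → ℤ}
    (δ : (ι → MvPolynomial (Fin n) k) →ₗ[MvPolynomial (Fin n) k] (κ → MvPolynomial (Fin n) k))
    (hδ : ∀ e x, IsHomogeneousFamily s e x → IsHomogeneousFamily t e (δ x)) {e : ℤ}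
    {y : ι → MvPolynomial (Fin n) k} (hy : IsHomogeneousFamily t e (δ y)) :
    ∃ y', IsHomogeneousFamily s e y' ∧ δ y' = δ y := by
  classical
  refine ⟨_, isHomogeneousFamily_component s e y, ?_⟩
  obtain ⟨E, heE, hE⟩ := exists_sum_homogeneousFamilyComponent s e y
  have key (j : ℤ) (c : κ) (a : Fin n →₀ ℕ) (h : (a.degree : ℤ) + t c ≠ j) :
      coeff a (δ (homogeneousFamilyComponent s j y) c) = 0 := by
    by_contra h0
    exact h (hδ j _ (isHomogeneousFamily_component s j y) c a (mem_support_iff.mpr h0))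
  ext c a
  by_cases h : (a.degree : ℤ) + t c = e
  · conv_rhs => rw [← hE, map_sum, Finset.sum_apply, coeff_sum]
    rw [Finset.sum_eq_single_of_mem e heE]
    intro j _ hj
    exact key j c a fun h' => hj (h'.symm.trans h)
  · rw [key e c a h]
    by_contra h0
    exact h (hy c a (mem_support_iff.mpr fun h' => h0 h'.symm))

theorem exists_lift {M N : Type*} [AddCommGroup M] [AddCommGroup N] {R : Type*} [CommRing R]
    [Module R M] [Module R N] [Finite ι] (φ : (ι → R) →ₗ[R] N) (δ : M →ₗ[R] N)
    (h : ∀ x, ∃ y, δ y = φ x) : ∃ l : (ι → R) →ₗ[R] M, ∀ x, δ (l x) = φ x := by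
  classical
  have := Fintype.ofFinite ι
  choose g hg using fun b : ι => h (Pi.single b 1)
  refine ⟨(Pi.basisFun R ι).constr R g, fun x => ?_⟩
  have : δ ∘ₗ (Pi.basisFun R ι).constr R g = φ := by
    refine (Pi.basisFun R ι).ext fun b => ?_
    rw [LinearMap.comp_apply, Module.Basis.constr_basis, hg, Pi.basisFun_apply]
  exact LinearMap.congr_fun this x

theorem exists_homogeneous_lift [Finite ι] [Finite μ] {s : ι → ℤ} {t : κ → ℤ} {v : μ → ℤ}
    (φ : (ι → MvPolynomial (Fin n) k) →ₗ[MvPolynomial (Fin n) k] (κ → MvPolynomial (Fin n) k))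
    (hφ : ∀ e x, IsHomogeneousFamily s e x → IsHomogeneousFamily t e (φ x))
    (δ : (μ → MvPolynomial (Fin n) k) →ₗ[MvPolynomial (Fin n) k] (κ → MvPolynomial (Fin n) k))
    (hδ : ∀ e x, IsHomogeneousFamily v e x → IsHomogeneousFamily t e (δ x))
    (h : ∀ x, ∃ y, δ y = φ x) :
    ∃ l : (ι → MvPolynomial (Fin n) k) →ₗ[MvPolynomial (Fin n) k] (μ → MvPolynomial (Fin n) k),
      (∀ x, δ (l x) = φ x) ∧
        ∀ e x, IsHomogeneousFamily s e x → IsHomogeneousFamily v e (l x) := by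
  classical
  have := Fintype.ofFinite ι
  have hex (b : ι) : ∃ y, IsHomogeneousFamily v (s b) y ∧ δ y = φ (Pi.single b 1) := by
    obtain ⟨y, hy⟩ := h (Pi.single b 1)
    rw [← hy]
    refine exists_homogeneous_preimage δ hδ ?_
    rw [hy]
    exact hφ _ _ (isHomogeneousFamily_single s b)
  choose g hgh hg using hex
  refine ⟨(Pi.basisFun _ ι).constr (MvPolynomial (Fin n) k) g, fun x => ?_, fun e x hx => ?_⟩
  · have : δ ∘ₗ (Pi.basisFun _ ι).constr (MvPolynomial (Fin n) k) g = φ := by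
      refine (Pi.basisFun _ ι).ext fun b => ?_
      rw [LinearMap.comp_apply, Module.Basis.constr_basis, hg, Pi.basisFun_apply]
    exact LinearMap.congr_fun this x
  · rw [Module.Basis.constr_apply_fintype]
    exact IsHomogeneousFamily.sum _ _ fun b _ => (hgh b).smul_of_support (hx b)

end HomogeneousLift

/-! ### Independence of the nonzero Betti positions from the resolution. -/

namespace MinimalGradedFreeResolution

variable {k : Type*} [Field k] {n : ℕ} {I : Ideal (MvPolynomial (Fin n) k)}

/-- The kernel of the map leaving the `i`-th term. -/
noncomputable def cycles (F : MinimalGradedFreeResolution I) :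
    ∀ i, Submodule (MvPolynomial (Fin n) k) (Fin (F.rank i) → MvPolynomial (Fin n) k)
  | 0 => LinearMap.ker F.aug
  | i + 1 => LinearMap.ker (F.diff i)

theorem mem_cycles_iff (F : MinimalGradedFreeResolution I) (i : ℕ)
    (x : Fin (F.rank i) → MvPolynomial (Fin n) k) : x ∈ F.cycles i ↔ ∃ y, F.diff i y = x := by
  cases i with
  | zero => exact F.exact_zero x
  | succ i => exact F.exact_succ i x

theorem constantCoeff_of_mem_cycles (F : MinimalGradedFreeResolution I) {i : ℕ}
    {x : Fin (F.rank i) → MvPolynomial (Fin n) k} (hx : x ∈ F.cycles i) (c : Fin (F.rank i)) :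
    constantCoeff (x c) = 0 := by
  obtain ⟨y, rfl⟩ := (F.mem_cycles_iff i x).mp hx
  exact F.minimal i y c

theorem exists_comparison_zero (F G : MinimalGradedFreeResolution I) :
    ∃ α : (Fin (F.rank 0) → MvPolynomial (Fin n) k) →ₗ[MvPolynomial (Fin n) k]
        (Fin (G.rank 0) → MvPolynomial (Fin n) k),
      (∀ x, G.aug (α x) = F.aug x) ∧
        ∀ e x, IsHomogeneousFamily (F.shift 0) e x → IsHomogeneousFamily (G.shift 0) e (α x) := by
  have aux (H : MinimalGradedFreeResolution I) (e : ℤ) (x)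
      (hx : IsHomogeneousFamily (H.shift 0) e x) :
      IsHomogeneousFamily (fun _ : Unit => 0) e
        (LinearMap.pi (fun _ : Unit => H.aug) x) := fun _ a ha => by
    simpa using H.aug_homogeneous e x hx a ha
  obtain ⟨α, hα, hα'⟩ := exists_homogeneous_lift (t := fun _ : Unit => 0)
    (LinearMap.pi fun _ => F.aug) (aux F) (LinearMap.pi fun _ => G.aug) (aux G) fun x => by
      obtain ⟨y, hy⟩ := (F.range_aug.trans G.range_aug.symm).le ⟨x, rfl⟩
      exact ⟨y, funext fun _ => hy⟩
  exact ⟨α, fun x => congrFun (hα x) (), hα'⟩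

/-- In each homological degree there are a graded map to the other resolution and a map back whose
composite is the identity modulo the irrelevant ideal. -/
theorem exists_comparison (F G : MinimalGradedFreeResolution I) (i : ℕ) :
    ∃ (α : (Fin (F.rank i) → MvPolynomial (Fin n) k) →ₗ[MvPolynomial (Fin n) k]
        (Fin (G.rank i) → MvPolynomial (Fin n) k))
      (β : (Fin (G.rank i) → MvPolynomial (Fin n) k) →ₗ[MvPolynomial (Fin n) k]
        (Fin (F.rank i) → MvPolynomial (Fin n) k))
      (σ : (Fin (F.rank i) → MvPolynomial (Fin n) k) →ₗ[MvPolynomial (Fin n) k]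
        (Fin (F.rank i) → MvPolynomial (Fin n) k)),
      (∀ e x, IsHomogeneousFamily (F.shift i) e x → IsHomogeneousFamily (G.shift i) e (α x)) ∧
      (∀ x ∈ F.cycles i, α x ∈ G.cycles i) ∧ (∀ x ∈ G.cycles i, β x ∈ F.cycles i) ∧
      (∀ x ∈ F.cycles i, σ x = 0) ∧ (∀ x c, constantCoeff (σ x c) = 0) ∧
      ∀ x, β (α x) - x - σ x ∈ F.cycles i := by
  induction i with
  | zero =>
    obtain ⟨α, hα, hα'⟩ := exists_comparison_zero F G
    obtain ⟨β, hβ, -⟩ := exists_comparison_zero G F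
    refine ⟨α, β, 0, hα', fun x hx => ?_, fun x hx => ?_, fun _ _ => rfl, ?_, fun x => ?_⟩
    · exact (hα x).trans hx
    · exact (hβ x).trans hx
    · simp
    · change F.aug _ = 0
      simp [hα, hβ]
  | succ i ih =>
    obtain ⟨α, β, σ, hα, hαZ, hβZ, hσZ, hσ, h⟩ := ih
    have hF (x) : F.diff i x ∈ F.cycles i := (F.mem_cycles_iff i _).mpr ⟨x, rfl⟩
    have hG (x) : G.diff i x ∈ G.cycles i := (G.mem_cycles_iff i _).mpr ⟨x, rfl⟩
    obtain ⟨α', hα', hα'h⟩ := exists_homogeneous_lift (t := G.shift i) (v := G.shift (i + 1))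
      (α ∘ₗ F.diff i) (fun e x hx => hα e _ (F.diff_homogeneous i e x hx)) (G.diff i)
      (G.diff_homogeneous i) fun x => (G.mem_cycles_iff i _).mp (hαZ _ (hF x))
    obtain ⟨β', hβ'⟩ := exists_lift (β ∘ₗ G.diff i) (F.diff i)
      fun x => (F.mem_cycles_iff i _).mp (hβZ _ (hG x))
    -- `τ` is the next piece of a homotopy from `β ∘ α` to the identity. Precomposed with the
    -- differential it becomes the new `σ`, which is minimal because the differential is; the other
    -- homotopy term is recorded only as membership in `cycles`.
    obtain ⟨τ, hτ⟩ := exists_lift (β ∘ₗ α - LinearMap.id - σ) (F.diff i)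
      fun x => (F.mem_cycles_iff i _).mp (h x)
    simp only [LinearMap.comp_apply, LinearMap.sub_apply, LinearMap.id_apply] at hα' hβ' hτ
    refine ⟨α', β', τ ∘ₗ F.diff i, hα'h, fun x hx => ?_, fun x hx => ?_, fun x hx => ?_,
      fun x c => ?_, fun x => ?_⟩
    · change F.diff i x = 0 at hx
      change G.diff i _ = 0
      rw [hα', hx, map_zero]
    · change G.diff i x = 0 at hx
      change F.diff i _ = 0
      rw [hβ', hx, map_zero]
    · change F.diff i x = 0 at hx
      rw [LinearMap.comp_apply, hx, map_zero]
    · exact CellComplex.constantCoeff_map_eq_zero τ (F.minimal i x) c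
    · change F.diff i _ = 0
      rw [map_sub, map_sub, hβ', hα', LinearMap.comp_apply, hτ, hσZ _ (hF x)]
      abel

/-- Modulo the irrelevant ideal both `σ` and the cycles vanish, so `β ∘ α` is the identity and `α`
cannot kill a basis vector. A nonzero constant entry of a graded map joins basis elements of equal
degree. -/
theorem exists_shift_eq (F G : MinimalGradedFreeResolution I) (i : ℕ) (b : Fin (F.rank i)) :
    ∃ c : Fin (G.rank i), G.shift i c = F.shift i b := by
  obtain ⟨α, β, σ, hα, -, -, -, hσ, h⟩ := exists_comparison F G i
  by_contra! hne
  have hαb : ∀ c, constantCoeff (α (Pi.single b 1) c) = 0 := by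
    intro c
    by_contra h0
    refine hne c ?_
    simpa using hα _ _ (isHomogeneousFamily_single (F.shift i) b) c 0 (mem_support_iff.mpr h0)
  have h1 := F.constantCoeff_of_mem_cycles (h (Pi.single b 1)) b
  simp only [Pi.sub_apply, map_sub, hσ, CellComplex.constantCoeff_map_eq_zero β hαb] at h1
  simp at h1

theorem betti_ne_zero_iff (F : MinimalGradedFreeResolution I) (i : ℕ) (j : ℤ) :
    F.betti i j ≠ 0 ↔ ∃ b, F.shift i b = j := by
  simp [betti, Finset.filter_eq_empty_iff]

theorem betti_ne_zero_congr (F G : MinimalGradedFreeResolution I) (i : ℕ) (j : ℤ) :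
    F.betti i j ≠ 0 ↔ G.betti i j ≠ 0 := by
  rw [betti_ne_zero_iff, betti_ne_zero_iff]
  constructor
  · rintro ⟨b, rfl⟩
    exact exists_shift_eq F G i b
  · rintro ⟨b, rfl⟩
    exact exists_shift_eq G F i b

end MinimalGradedFreeResolution

/-! ### From total objects to minimal graded free resolutions. -/

namespace CellComplex

variable {k : Type*} [Field k] {n : ℕ}

section Conversion

variable (A : CellComplex k n) [Finite A.Cell]

/-- An enumeration of the cells of homological degree `i`. -/
noncomputable def cellAt (i : ℕ) (j : Fin (Nat.card {b // A.hdeg b = i})) : A.Cell :=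
  ((Finite.equivFin {b // A.hdeg b = i}).symm j).1

theorem hdeg_cellAt (i : ℕ) (j) : A.hdeg (A.cellAt i j) = i :=
  ((Finite.equivFin {b // A.hdeg b = i}).symm j).2

theorem cellAt_injective (i : ℕ) : Function.Injective (A.cellAt i) :=
  Subtype.val_injective.comp (Equiv.injective _)

theorem exists_cellAt_eq {i : ℕ} {b : A.Cell} (hb : A.hdeg b = i) : ∃ j, A.cellAt i j = b :=
  ⟨Finite.equivFin {b // A.hdeg b = i} ⟨b, hb⟩, by simp [cellAt]⟩

/-- The inclusion of the part of homological degree `i`. -/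
noncomputable def incl (i : ℕ) :
    (Fin (Nat.card {b // A.hdeg b = i}) → MvPolynomial (Fin n) k) →ₗ[MvPolynomial (Fin n) k]
      A.Mod :=
  Function.ExtendByZero.linearMap (MvPolynomial (Fin n) k) (A.cellAt i)

/-- The projection to the part of homological degree `i`. -/
noncomputable def proj (i : ℕ) :
    A.Mod →ₗ[MvPolynomial (Fin n) k]
      (Fin (Nat.card {b // A.hdeg b = i}) → MvPolynomial (Fin n) k) :=
  LinearMap.funLeft _ _ (A.cellAt i)

theorem incl_cellAt (i : ℕ) (x) (j) : A.incl i x (A.cellAt i j) = x j :=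
  (A.cellAt_injective i).extend_apply _ _ _

theorem incl_of_ne {i : ℕ} (x) {b : A.Cell} (hb : A.hdeg b ≠ i) : A.incl i x b = 0 :=
  Function.extend_apply' _ _ _ fun ⟨j, hj⟩ => hb (hj ▸ A.hdeg_cellAt i j)

theorem proj_incl (i : ℕ) (x) : A.proj i (A.incl i x) = x :=
  funext fun j => A.incl_cellAt i x j

theorem incl_proj_apply {i : ℕ} (x : A.Mod) {b : A.Cell} (hb : A.hdeg b = i) :
    A.incl i (A.proj i x) b = x b := by
  obtain ⟨j, rfl⟩ := A.exists_cellAt_eq hb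
  exact A.incl_cellAt i _ j

theorem incl_proj {i : ℕ} {x : A.Mod} (hx : ∀ b, A.hdeg b ≠ i → x b = 0) :
    A.incl i (A.proj i x) = x := by
  ext1 b
  by_cases hb : A.hdeg b = i
  · exact A.incl_proj_apply x hb
  · rw [A.incl_of_ne _ hb, hx b hb]

theorem isHomogeneousFamily_incl {i : ℕ} {e : ℤ} {x}
    (hx : IsHomogeneousVector (fun j => A.deg (A.cellAt i j)) e x) :
    IsHomogeneousFamily A.deg e (A.incl i x) := by
  intro b
  by_cases hb : A.hdeg b = i
  · obtain ⟨j, rfl⟩ := A.exists_cellAt_eq hb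
    rw [incl_cellAt]
    exact hx j
  · simp [A.incl_of_ne x hb]

variable {A} {I : Ideal (MvPolynomial (Fin n) k)}

theorem Resolves.incl_proj_D_incl (h : A.Resolves I) (i : ℕ) (x) :
    A.incl i (A.proj i (A.D (A.incl (i + 1) x))) = A.D (A.incl (i + 1) x) :=
  A.incl_proj fun b hb => h.D_local _ b fun c hc => A.incl_of_ne x (by omega)

theorem Resolves.proj_D_incl_proj (h : A.Resolves I) (i : ℕ) (x : A.Mod) :
    A.proj i (A.D (A.incl (i + 1) (A.proj (i + 1) x))) = A.proj i (A.D x) := by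
  ext1 j
  rw [← sub_eq_zero]
  have := h.D_local (A.incl (i + 1) (A.proj (i + 1) x) - x) (A.cellAt i j) fun c hc => by
    rw [A.hdeg_cellAt] at hc
    rw [Pi.sub_apply, A.incl_proj_apply x hc, sub_self]
  rw [map_sub] at this
  exact this

theorem Resolves.ε_incl_proj (h : A.Resolves I) (x : A.Mod) :
    A.ε (A.incl 0 (A.proj 0 x)) = A.ε x := by
  rw [← sub_eq_zero, ← map_sub]
  exact h.ε_local _ fun c hc => by rw [Pi.sub_apply, A.incl_proj_apply x hc, sub_self]

theorem Resolves.D_incl_zero (h : A.Resolves I) (x) : A.D (A.incl 0 x) = 0 :=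
  funext fun b => h.D_local _ b fun c hc => A.incl_of_ne x (by omega)

theorem Resolves.ε_incl_succ (h : A.Resolves I) (i : ℕ) (x) : A.ε (A.incl (i + 1) x) = 0 :=
  h.ε_local _ fun c hc => A.incl_of_ne x (by omega)

/-- The minimal graded free resolution whose total object is the given cell complex. -/
noncomputable def Resolves.resolution (h : A.Resolves I) : MinimalGradedFreeResolution I where
  rank i := Nat.card {b // A.hdeg b = i}
  shift i j := A.deg (A.cellAt i j)
  aug := A.ε ∘ₗ A.incl 0
  diff i := A.proj i ∘ₗ A.D ∘ₗ A.incl (i + 1)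
  aug_homogeneous e x hx := h.ε_homogeneous e _ (A.isHomogeneousFamily_incl hx)
  diff_homogeneous i e x hx c :=
    h.D_homogeneous e _ (A.isHomogeneousFamily_incl hx) (A.cellAt i c)
  range_aug := by
    apply le_antisymm
    · rintro _ ⟨x, rfl⟩
      exact h.ε_mem _
    · intro p hp
      obtain ⟨x, -, rfl⟩ := h.exists_ε_eq p hp
      exact ⟨A.proj 0 x, h.ε_incl_proj x⟩
  exact_zero x := by
    simp only [LinearMap.comp_apply]
    constructor
    · intro hx
      obtain ⟨y, hy⟩ := h.exact (A.incl 0 x) (h.D_incl_zero x) hx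
      refine ⟨A.proj 1 y, ?_⟩
      simp only [LinearMap.comp_apply]
      rw [h.proj_D_incl_proj, hy, proj_incl]
    · rintro ⟨y, rfl⟩
      simp only [LinearMap.comp_apply]
      rw [h.incl_proj_D_incl, h.ε_D]
  exact_succ i x := by
    simp only [LinearMap.comp_apply]
    constructor
    · intro hx
      obtain ⟨y, hy⟩ := h.exact (A.incl (i + 1) x)
        (by rw [← h.incl_proj_D_incl, hx, map_zero]) (h.ε_incl_succ i x)
      refine ⟨A.proj (i + 2) y, ?_⟩
      simp only [LinearMap.comp_apply]
      rw [h.proj_D_incl_proj, hy, proj_incl]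
    · rintro ⟨y, rfl⟩
      simp only [LinearMap.comp_apply]
      rw [h.incl_proj_D_incl, h.D_D, map_zero]
  minimal i x c := h.minimal _ _
  finite_length := by
    obtain ⟨p, hp⟩ := (Set.finite_range A.hdeg).bddAbove
    refine ⟨p, fun i hi => ?_⟩
    have : IsEmpty {b // A.hdeg b = i} :=
      ⟨fun b => hi.not_ge (b.2 ▸ hp ⟨b.1, rfl⟩)⟩
    exact Nat.card_of_isEmpty

theorem Resolves.hasRegularity (h : A.Resolves I) {m : ℤ} (hm : A.HasTop m) :
    HasRegularity I m := by
  refine ⟨⟨h.resolution⟩, fun F => ?_⟩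
  simp_rw [F.betti_ne_zero_congr h.resolution, MinimalGradedFreeResolution.betti_ne_zero_iff]
  constructor
  · obtain ⟨⟨b, hb⟩, -⟩ := hm
    obtain ⟨j, hj⟩ := A.exists_cellAt_eq (b := b) rfl
    exact ⟨A.hdeg b, A.deg b, ⟨j, congrArg A.deg hj⟩, hb.symm⟩
  · rintro _ ⟨i, _, ⟨j, rfl⟩, rfl⟩
    refine le_trans (le_of_eq ?_) (hm.2 (A.cellAt i j))
    exact congrArg (fun l : ℕ => A.deg (A.cellAt i j) - (l : ℤ)) (A.hdeg_cellAt i j).symm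

end Conversion

/-! ### Regularity of a cone. -/

section HasTop

variable {A B : CellComplex k n} {ψ : A.Mod →ₗ[MvPolynomial (Fin n) k] B.Mod}
  {f : MvPolynomial (Fin n) k} {d : ℕ}

/-- The shifted copy of `A` contributes `a + d - 1`, its homological degree being raised by one; the
shifted `B` contributes `b + d`. The unshifted `A` contributes `a`, which is dominated because `d ≥
1`. -/
theorem HasTop.cone {a b : ℤ} (hA : A.HasTop a) (hB : B.HasTop b) (hd : 1 ≤ d) :
    (cone A B ψ f d).HasTop (max (a + d - 1) (b + d)) := by
  obtain ⟨⟨p, hp⟩, ha⟩ := hA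
  obtain ⟨⟨q, hq⟩, hb⟩ := hB
  constructor
  · rcases le_total (a + d - 1) (b + d) with h | h
    · refine ⟨Sum.inr (Sum.inr q), ?_⟩
      change B.deg q + d - (B.hdeg q : ℤ) = _
      omega
    · refine ⟨Sum.inl p, ?_⟩
      change A.deg p + d - ((A.hdeg p + 1 : ℕ) : ℤ) = _
      omega
  · rintro (c | c | c)
    · have := ha c
      change A.deg c + d - ((A.hdeg c + 1 : ℕ) : ℤ) ≤ _
      omega
    · have := ha c
      change A.deg c - (A.hdeg c : ℤ) ≤ _
      omega
    · have := hb c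
      change B.deg c + d - (B.hdeg c : ℤ) ≤ _
      omega

/-- Needed for the first generator, where the positive powers of `J = 0` have no cells and hence no
top value. -/
theorem HasTop.cone_of_isEmpty [IsEmpty A.Cell] {b : ℤ} (hB : B.HasTop b) :
    (CellComplex.cone A B ψ f d).HasTop (b + d) := by
  obtain ⟨⟨q, hq⟩, hb⟩ := hB
  constructor
  · refine ⟨Sum.inr (Sum.inr q), ?_⟩
    change B.deg q + d - (B.hdeg q : ℤ) = _
    omega
  · rintro (c | c | c)
    · exact isEmptyElim c
    · exact isEmptyElim c
    · have := hb c
      change B.deg c + d - (B.hdeg c : ℤ) ≤ _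
      omega

end HasTop

/-! ### Towers resolving all powers of an ideal, and adjoining a generator. -/

/-- A sequence of cell complexes with linear maps between successive ones. -/
structure Tower (k : Type*) [Field k] (n : ℕ) where
  /-- The cell complexes. -/
  obj : ℕ → CellComplex k n
  /-- The maps. -/
  map : ∀ t, (obj (t + 1)).Mod →ₗ[MvPolynomial (Fin n) k] (obj t).Mod

/-- The complexes resolve the powers of `J`, and the maps are minimal lifts of the inclusions
`J ^ (t + 1) ≤ J ^ t`. -/
structure Tower.ResolvesPowers (T : Tower k n) (J : Ideal (MvPolynomial (Fin n) k)) : Prop where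
  resolves : ∀ t, (T.obj t).Resolves (J ^ t)
  isMorphism : ∀ t, IsMorphism (T.obj (t + 1)) (T.obj t) (T.map t)
  isMinimalMap : ∀ t, IsMinimalMap (T.obj (t + 1)) (T.obj t) (T.map t)

/-- The polynomial ring as a complex with one cell. -/
noncomputable def unit (k : Type*) [Field k] (n : ℕ) : CellComplex k n where
  Cell := Unit
  hdeg _ := 0
  deg _ := 0
  D := 0
  ε := LinearMap.proj ()

/-- The complex without cells. -/
noncomputable def empty (k : Type*) [Field k] (n : ℕ) : CellComplex k n where
  Cell := Empty
  hdeg _ := 0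
  deg _ := 0
  D := 0
  ε := 0

theorem resolves_unit : (unit k n).Resolves ⊤ where
  finite := inferInstanceAs (Finite Unit)
  D_homogeneous _ _ _ := isHomogeneousFamily_zero
  D_local _ _ _ := rfl
  ε_homogeneous e x hx a ha := by simpa [unit] using hx () a ha
  ε_local x hx := hx () rfl
  minimal _ _ := map_zero _
  D_D _ := rfl
  ε_D _ := rfl
  exact x _ hx := ⟨0, funext fun _ => Eq.symm hx⟩
  ε_mem _ := trivial
  exists_ε_eq p _ := ⟨fun _ => p, rfl, rfl⟩

theorem resolves_empty : (empty k n).Resolves ⊥ where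
  finite := inferInstanceAs (Finite Empty)
  D_homogeneous _ _ _ := isHomogeneousFamily_zero
  D_local _ _ _ := rfl
  ε_homogeneous _ _ _ _ ha := absurd rfl (mem_support_iff.mp ha)
  ε_local _ _ := rfl
  minimal _ _ := map_zero _
  D_D _ := rfl
  ε_D _ := rfl
  exact _ _ _ := ⟨0, funext fun c => Empty.elim c⟩
  ε_mem _ := rfl
  exists_ε_eq _ hp := ⟨0, rfl, hp.symm⟩

/-- The tower of the zero ideal. -/
noncomputable def Tower.base (k : Type*) [Field k] (n : ℕ) : Tower k n where
  obj t := Nat.casesOn t (unit k n) fun _ => empty k n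
  map _ := 0

theorem Tower.resolvesPowers_base : (Tower.base k n).ResolvesPowers ⊥ where
  resolves t := by
    cases t with
    | zero =>
      rw [pow_zero, Ideal.one_eq_top]
      exact resolves_unit
    | succ t =>
      rw [Ideal.bot_pow (Nat.succ_ne_zero t)]
      exact resolves_empty
  -- Every source is the complex without cells, so only the zero map is available.
  isMorphism t :=
    { D_comm := fun _ => (map_zero ((Tower.base k n).obj t).D).symm
      ε_comm := fun _ => map_zero ((Tower.base k n).obj t).ε
      homogeneous := fun _ _ _ => isHomogeneousFamily_zero
      local_apply := fun _ _ _ => rfl }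
  isMinimalMap _ _ _ := map_zero _

/-- A cell complex with a map from `A` to it. -/
structure Under (A : CellComplex k n) where
  /-- The complex. -/
  obj : CellComplex k n
  /-- The map. -/
  map : A.Mod →ₗ[MvPolynomial (Fin n) k] obj.Mod

namespace Tower

variable (T : Tower k n) (f : MvPolynomial (Fin n) k) (d : ℕ)

/-- The complexes in the tower of `J + (f)`, built from the tower of `J` as iterated cones. -/
noncomputable def adjoinUnder : ∀ t, Under (T.obj t)
  -- Both zeroth powers are the unit ideal. The recursion carries the map from `T.obj t` because the
  -- next cone is taken along its composite with `T.map t`.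
  | 0 => ⟨T.obj 0, LinearMap.id⟩
  | t + 1 =>
    ⟨cone (T.obj (t + 1)) (adjoinUnder t).obj ((adjoinUnder t).map ∘ₗ T.map t) f d,
      coneInclusion _ _ _ f d⟩

/-- The tower of `J + (f)` built from the tower of `J`. -/
noncomputable def adjoin : Tower k n where
  obj t := (T.adjoinUnder f d t).obj
  map t := coneProjection (T.obj (t + 1)) (T.adjoinUnder f d t).obj
    ((T.adjoinUnder f d t).map ∘ₗ T.map t) f d

variable {T f d} {J : Ideal (MvPolynomial (Fin n) k)}

theorem isMorphism_adjoinUnder (t : ℕ) :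
    IsMorphism (T.obj t) (T.adjoinUnder f d t).obj (T.adjoinUnder f d t).map := by
  cases t with
  | zero => exact isMorphism_id _
  | succ t => exact isMorphism_coneInclusion

/-- The first factor, `T.map t`, already has its image in the multiples of the irrelevant ideal, and
linear maps preserve this; the second factor may be an inclusion with unit entries. -/
theorem ResolvesPowers.isMinimalMap_comp (hT : T.ResolvesPowers J) (t : ℕ) :
    IsMinimalMap (T.obj (t + 1)) (T.adjoinUnder f d t).obj
      ((T.adjoinUnder f d t).map ∘ₗ T.map t) := by
  have := (hT.resolves t).finite
  exact fun x => constantCoeff_map_eq_zero (T.adjoinUnder f d t).map (hT.isMinimalMap t x)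

theorem ResolvesPowers.adjoin (hT : T.ResolvesPowers J) (hf : f.IsHomogeneous d)
    (hfc : constantCoeff f = 0) (hf0 : f ≠ 0)
    (hfJ : ∀ t x, f * x ∈ J ^ t → x ∈ J ^ t) :
    (T.adjoin f d).ResolvesPowers (J ⊔ Ideal.span {f}) where
  resolves t := by
    induction t with
    | zero =>
      have := hT.resolves 0
      rw [pow_zero] at this ⊢
      exact this
    | succ t ih =>
      rw [Ideal.sup_span_singleton_pow_succ]
      exact resolves_cone (hT.resolves (t + 1)) ih
        ((isMorphism_adjoinUnder t).comp (hT.isMorphism t)) (hT.isMinimalMap_comp t) hf hfc hf0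
        (hfJ (t + 1))
  isMorphism t := isMorphism_coneProjection
    ((isMorphism_adjoinUnder t).comp (hT.isMorphism t)) hf
  isMinimalMap t := isMinimalMap_coneProjection (hT.isMinimalMap_comp t) hfc

theorem hasTop_adjoin_of_isEmpty (h0 : (T.obj 0).HasTop 0)
    (hT : ∀ t, IsEmpty (T.obj (t + 1)).Cell) (t : ℕ) :
    ((T.adjoin f d).obj t).HasTop (t * d) := by
  induction t with
  | zero =>
    rw [Nat.cast_zero, zero_mul]
    exact h0
  | succ t ih =>
    have := hT t
    have h : ((t + 1 : ℕ) : ℤ) * d = t * d + d := by push_cast; ring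
    rw [h]
    exact ih.cone_of_isEmpty

/-- Solves the recursion for the maximum. At the start `s ≥ 1` makes the term from `J` win over `0 +
d`; afterwards the term from `J` wins when `w ≥ d`, and the term from the previous power when `d ≥
w`. -/
theorem hasTop_adjoin {s : ℤ} {w : ℕ} (hs : 1 ≤ s) (hd : 1 ≤ d) (h0 : (T.obj 0).HasTop 0)
    (hT : ∀ t : ℕ, (T.obj (t + 1)).HasTop (s + t * w)) (t : ℕ) :
    ((T.adjoin f d).obj (t + 1)).HasTop (s + d - 1 + t * (max w d : ℕ)) := by
  induction t with
  | zero =>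
    have h : s + d - 1 + ((0 : ℕ) : ℤ) * (max w d : ℕ) =
        max (s + ((0 : ℕ) : ℤ) * w + d - 1) (0 + d) := by
      simp only [Nat.cast_zero, zero_mul]
      omega
    rw [h]
    exact (hT 0).cone h0 hd
  | succ t ih =>
    have h : s + d - 1 + ((t + 1 : ℕ) : ℤ) * (max w d : ℕ) =
        max (s + ((t + 1 : ℕ) : ℤ) * w + d - 1) (s + d - 1 + t * (max w d : ℕ) + d) := by
      have ht : (0 : ℤ) ≤ t := Int.natCast_nonneg t
      rcases le_total w d with hw | hw
      · rw [max_eq_right hw, max_eq_right]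
        · push_cast; ring
        · have : (t + 1) * (w : ℤ) ≤ (t + 1) * d := by gcongr
          push_cast
          linarith
      · rw [max_eq_left hw, max_eq_left]
        · push_cast; ring
        · have : (d : ℤ) ≤ w := by exact_mod_cast hw
          push_cast
          linarith
    rw [h]
    exact (hT (t + 1)).cone ih hd

theorem exists_resolvesPowers {r : ℕ} (u : Fin r → MvPolynomial (Fin n) k) (d : Fin r → ℕ)
    (hu : ∀ i, (u i).IsHomogeneous (d i)) (hd : ∀ i, 1 ≤ d i) (hu0 : ∀ i, u i ≠ 0)
    (huc : ∀ i, constantCoeff (u i) = 0)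
    (hreg : ∀ i x, u i * x ∈ Ideal.span (u '' Set.Iio i) → x ∈ Ideal.span (u '' Set.Iio i)) :
    (Ideal.span (Set.range u)).PreservesNonzerodivisors ∧
    ∃ T : Tower k n, T.ResolvesPowers (Ideal.span (Set.range u)) ∧
      (T.obj 0).HasTop 0 ∧ (r = 0 → ∀ t, IsEmpty (T.obj (t + 1)).Cell) ∧
      (0 < r → ∀ t : ℕ, (T.obj (t + 1)).HasTop
        ((∑ i, (d i : ℤ)) - ((r : ℤ) - 1) + t * (Finset.univ.sup d : ℕ))) := by
  induction r with
  | zero =>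
    rw [Set.range_eq_empty, Ideal.span_empty]
    refine ⟨Ideal.preservesNonzerodivisors_bot, base k n, resolvesPowers_base,
      ⟨⟨(), rfl⟩, fun _ => le_rfl⟩, fun _ t => inferInstanceAs (IsEmpty Empty), fun h => ?_⟩
    exact absurd h (lt_irrefl 0)
  | succ r ih =>
    have hIio (i : Fin r) : u '' Set.Iio i.castSucc = (u ∘ Fin.castSucc) '' Set.Iio i := by
      rw [Set.image_comp]
      congr 1
      ext j
      constructor
      · intro hj
        have hj' : j < i.castSucc := hj
        exact ⟨j.castLT (lt_trans hj' i.2), hj', rfl⟩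
      · rintro ⟨l, hl, rfl⟩
        exact hl
    have hlast : u '' Set.Iio (Fin.last r) = Set.range (u ∘ Fin.castSucc) := by
      rw [Set.range_comp]
      congr 1
      ext j
      constructor
      · intro hj
        exact ⟨j.castLT hj, rfl⟩
      · rintro ⟨l, rfl⟩
        exact l.2
    have hspan : Ideal.span (Set.range u) =
        Ideal.span (Set.range (u ∘ Fin.castSucc)) ⊔ Ideal.span {u (Fin.last r)} := by
      rw [← Ideal.span_union]
      congr 1
      ext p
      simp [Fin.exists_fin_succ', eq_comm, or_comm]
    obtain ⟨hJ, T, hT, h0, hempty, htop⟩ := ih (u ∘ Fin.castSucc) (d ∘ Fin.castSucc)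
      (fun i => hu _) (fun i => hd _) (fun i => hu0 _) (fun i => huc _) fun i x => by
        rw [← hIio]
        exact hreg i.castSucc x
    have hnzd := hreg (Fin.last r)
    rw [hlast] at hnzd
    rw [hspan]
    refine ⟨hJ.sup_span_singleton hnzd, T.adjoin (u (Fin.last r)) (d (Fin.last r)),
      hT.adjoin (hu _) (huc _) (hu0 _) fun t x hx => hJ.mem_pow hnzd t hx, h0,
      fun h => absurd h (Nat.succ_ne_zero r), fun _ t => ?_⟩
    have hsup : Finset.univ.sup d = max (Finset.univ.sup (d ∘ Fin.castSucc)) (d (Fin.last r)) := by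
      rw [Fin.univ_castSuccEmb, Finset.sup_cons, Finset.sup_map, sup_comm]
      rfl
    rw [hsup, Fin.sum_univ_castSucc]
    rcases Nat.eq_zero_or_pos r with rfl | hr
    · have := hasTop_adjoin_of_isEmpty (f := u (Fin.last 0)) (d := d (Fin.last 0)) h0
        (hempty rfl) (t + 1)
      convert! this using 1
      simp
      ring
    -- Each degree is at least one, so the sum is at least `r`.
    · have hs : (1 : ℤ) ≤ (∑ i : Fin r, ((d ∘ Fin.castSucc) i : ℤ)) - ((r : ℤ) - 1) := by
        have h : (∑ _i : Fin r, (1 : ℤ)) ≤ ∑ i : Fin r, ((d ∘ Fin.castSucc) i : ℤ) :=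
          Finset.sum_le_sum fun i _ => by exact_mod_cast hd i.castSucc
        simp only [Finset.sum_const, Finset.card_univ, Fintype.card_fin, nsmul_eq_mul,
          mul_one] at h
        linarith
      have := hasTop_adjoin (f := u (Fin.last r)) hs (hd (Fin.last r)) h0 (htop hr) t
      convert! this using 1
      push_cast
      simp only [Function.comp_apply]
      ring

end Tower

end CellComplex

/-! ### The hypotheses on the regular sequence, and the conclusion. -/

theorem RingTheory.Sequence.IsWeaklyRegular.mem_span_image_Iio {R : Type*} [CommRing R] {r : ℕ}
    {u : Fin r → R} (h : RingTheory.Sequence.IsWeaklyRegular R (List.ofFn u)) (i : Fin r) {x : R}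
    (hx : u i * x ∈ Ideal.span (u '' Set.Iio i)) : x ∈ Ideal.span (u '' Set.Iio i) := by
  have key : (Ideal.ofList ((List.ofFn u).take i) • ⊤ : Submodule R R) =
      Ideal.span (u '' Set.Iio i) := by
    rw [smul_eq_mul, Ideal.mul_top, Ideal.ofList]
    congr 1
    ext p
    simp only [Set.mem_ofPred_eq, Set.mem_image, Set.mem_Iio, List.mem_take_iff_getElem,
      List.getElem_ofFn, List.length_ofFn]
    constructor
    · rintro ⟨j, hj, rfl⟩
      exact ⟨⟨j, by omega⟩, Fin.lt_def.mpr (by simp; omega), rfl⟩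
    · rintro ⟨j, hj, rfl⟩
      exact ⟨j, by have := Fin.lt_def.mp hj; omega, rfl⟩
  have hreg := h.regular_mod_prev i (by simp)
  rw [key] at hreg
  rw [← Ideal.Quotient.eq_zero_iff_mem] at hx ⊢
  refine hreg ?_
  simp only [List.getElem_ofFn, smul_zero]
  exact hx

theorem theorem3p3 {k : Type*} [Field k] {n r : ℕ} (hr : 0 < r)
    (u : Fin r → MvPolynomial (Fin n) k) (d : Fin r → ℕ)
    (hu : ∀ i, (u i).IsHomogeneous (d i))
    (hreg : RingTheory.Sequence.IsRegular (MvPolynomial (Fin n) k) (List.ofFn u))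
    (t : ℕ) (ht : 1 ≤ t) :
    HasRegularity (Ideal.span (Set.range u) ^ t)
      ((∑ i, (d i : ℤ)) - ((r : ℤ) - 1) + ((t : ℤ) - 1) * ((Finset.univ.sup d : ℕ) : ℤ)) := by
  have hnzd (i : Fin r) (x) (hx : u i * x ∈ Ideal.span (u '' Set.Iio i)) :=
    hreg.toIsWeaklyRegular.mem_span_image_Iio i hx
  have hne : Ideal.span (Set.range u) ≠ ⊤ := by
    have := hreg.top_ne_smul
    rw [smul_eq_mul, Ideal.mul_top, Ideal.ofList] at this
    simp only [List.mem_ofFn] at this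
    exact this.symm
  have hu0 (i : Fin r) : u i ≠ 0 := by
    intro h
    refine hne (top_le_iff.mp fun x _ => ?_)
    -- If `u i = 0`, then `u i * x` lies in the preceding ideal for every `x`, which forces that
    -- ideal to be everything.
    exact Ideal.span_mono (Set.image_subset_range _ _) (hnzd i x (by simp [h]))
  have hd (i : Fin r) : 1 ≤ d i := by
    by_contra h
    -- A nonzero form of degree zero is a unit, which a proper ideal cannot contain.
    have h0 : (u i).totalDegree = 0 := by
      rw [(hu i).totalDegree (hu0 i)]
      omega
    rw [totalDegree_eq_zero_iff_eq_C] at h0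
    refine hne (Ideal.eq_top_of_isUnit_mem _ (Ideal.subset_span ⟨i, rfl⟩) ?_)
    rw [h0, isUnit_map_iff, isUnit_iff_ne_zero]
    intro hc
    exact hu0 i (by rw [h0, hc, C_0])
  have huc (i : Fin r) : constantCoeff (u i) = 0 := by
    by_contra h
    have := hu i h
    have hdi := hd i
    simp at this
    omega
  obtain ⟨-, T, hT, -, -, htop⟩ := CellComplex.Tower.exists_resolvesPowers u d hu hd hu0 huc hnzd
  obtain ⟨t, rfl⟩ := Nat.exists_eq_add_of_le' ht
  have := (hT.resolves (t + 1)).finite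
  have := (hT.resolves (t + 1)).hasRegularity (htop hr t)
  simpa using this
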